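/- Let $k$ be an infinite field, let $I$ be a homogeneous ideal of $R=k[x_1,\dots,x_n]$ (with $\deg x_j=1$ for all $j$), and suppose that $A=R/I$ is artinian. Let $h=(h_0,h_1,\dots,h_e)$ be its $h$-vector, where $h_i=\dim_k A_i$ and the socle degree $e$ is the last index with $A_e\neq 0$. Assume that $e\ge 2$ and that $A$ is level of type $t$, that is, its socle $\mathrm{soc}(A)=\{a\in A : a\,\bar x_j=0 \text{ for } j=1,\dots,n\}$ satisfies $\dim_k \mathrm{soc}(A)_i=0$ for all $i<e$ and $\dim_k \mathrm{soc}(A)_e=t$. If the codimension $r=h_1$ of $A$ is at most $7$, then $h_{e-1}\ge r$. In other words: if $h=(1,r,\dots,a,t)$ is the $h$-vector of a level algebra of type $t$ and $r\le 7$, then $a\ge r$. -/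

import Mathlib

namespace LevelAlgebra

attribute [local instance] MvPolynomial.gradedAlgebra

variable {k : Type*} [Field k] {n : ℕ}

/-- The degree `i` component `A_i` of `A = k[x_1, …, x_n] / I`: the image of the space of forms of
degree `i`. -/
noncomputable def component (I : Ideal (MvPolynomial (Fin n) k)) (i : ℕ) :
    Submodule k (MvPolynomial (Fin n) k ⧸ I) :=
  (MvPolynomial.homogeneousSubmodule (Fin n) k i).map (Ideal.Quotient.mkₐ k I).toLinearMap

/-- The entries `h_i = dim_k A_i` of the `h`-vector of `A = k[x_1, …, x_n] / I`. -/
noncomputable def hVector (I : Ideal (MvPolynomial (Fin n) k)) (i : ℕ) : ℕ :=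
  Module.finrank k (component I i)

/-- The codimension of `A = k[x_1, …, x_n] / I`, namely `h_1` (which is the number `n` of variables
when `I` contains no non-zero linear form). -/
noncomputable def codimension (I : Ideal (MvPolynomial (Fin n) k)) : ℕ :=
  hVector I 1

/-- The ideal of `A = k[x_1, …, x_n] / I` generated by the classes of the variables. -/
noncomputable def maximalHomogeneousIdeal (I : Ideal (MvPolynomial (Fin n) k)) :
    Ideal (MvPolynomial (Fin n) k ⧸ I) :=
  Ideal.span (Set.range fun j : Fin n => Ideal.Quotient.mk I (MvPolynomial.X j))

/-- The socle of `A`: the annihilator of its maximal homogeneous ideal. -/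
noncomputable def socle (I : Ideal (MvPolynomial (Fin n) k)) :
    Ideal (MvPolynomial (Fin n) k ⧸ I) :=
  Submodule.annihilator (maximalHomogeneousIdeal I)

/-- The entries `s_i = dim_k soc(A)_i` of the socle-vector of `A`, where
`soc(A)_i = soc(A) ∩ A_i`. -/
noncomputable def socleVector (I : Ideal (MvPolynomial (Fin n) k)) (i : ℕ) : ℕ :=
  Module.finrank k ↥((socle I).restrictScalars k ⊓ component I i)

/-- `A = k[x_1, …, x_n] / I` is a standard graded artinian algebra of socle degree `e`, that is,
`e` is the last index with `A_e ≠ 0`. -/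
structure IsArtinianOfSocleDegree (I : Ideal (MvPolynomial (Fin n) k)) (e : ℕ) : Prop where
  isHomogeneous : I.IsHomogeneous (MvPolynomial.homogeneousSubmodule (Fin n) k)
  isArtinianRing : IsArtinianRing (MvPolynomial (Fin n) k ⧸ I)
  hVector_pos : 0 < hVector I e
  hVector_eq_zero : ∀ i, e < i → hVector I i = 0

/-- `A = k[x_1, …, x_n] / I` is a level algebra of socle degree `e` and type `t`: its socle-vector
is `(0, …, 0, s_e = t)`. -/
structure IsLevel (I : Ideal (MvPolynomial (Fin n) k)) (e t : ℕ) : Prop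
    extends IsArtinianOfSocleDegree I e where
  socleVector_eq_zero : ∀ i, i < e → socleVector I i = 0
  socleVector_eq_type : socleVector I e = t

end LevelAlgebra

/-!
The inequality is a statement about the multiplication `A₁ × A_{e-1} → A_e`, and it is proved by
linear algebra inside a commutative algebra `A`, for a finite-dimensional subspace `V` (here `A₁`)
and its powers `V ^ m`, `V ^ (m + 1)` (here `A_{e-2}`, `A_{e-1}`). Levelness is used only through
its consequence that no non-zero element of `V` annihilates `V ^ (m + 1)`.

A functional `ψ` on `A` gives the bilinear form `(v, b) ↦ ψ (v b)` on `V × V ^ (m + 1)`. Fix `φ`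
for which this form has the largest rank `ρ`, and let `K ⊆ V` be its left kernel, of dimension
`s = r - ρ`. The product `K V ^ m` lies in the right kernel, so that
`ρ + dim (K V ^ m) ≤ dim V ^ (m + 1)`, and it is enough to show `s ≤ dim (K V ^ m)`. Since the
field is infinite, maximality of the rank yields (`mem_range_of_forall_finrank_range_le`): for all
`y ∈ K` and all `ψ` there is `D ∈ V` with `ψ (y b) = φ (D b)` for every `b ∈ V ^ (m + 1)`.

The inequality `dim N ≤ dim (N V ^ m)` holds for all subspaces `N ⊆ K`, by induction on `dim N`
(`finrank_le_finrank_mul_pow`). Choose `ψ` whose form has non-zero rank `d` on `N`. Let `N₁ ⊂ N` be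
the left kernel of that restriction, and let `σ` be the rank of the pairing of `V` with `N V ^ m`
given by `ψ`. Then `dim (N V ^ m) ≥ σ + dim (N₁ V ^ m)`, so the point is to see that `d ≤ σ`
(`finrank_map_pairing_le_finrank_range`). If a functional kills all products `n u c` with `n` in a
subspace of `V`, `u ∈ U` and `c ∈ V ^ m`, where `U` has codimension at most one in `V`, then
`ψ (n b)` depends only on the coefficient of `x ^ (m + 1)` in `b`, where `V = U + ⟨x⟩`; this is
`finrank_map_pairing_add_le`. Applied once to `ψ` and once to `φ`, it gives `d ≤ σ` when `σ ≤ 1`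
and when `ρ - d ≤ 1`. In the remaining case `σ < d` forces `d ≥ 3` and `ρ ≥ d + 2`, while `d ≤ s`,
so that `r = ρ + s ≥ 8`.
-/

open Module

namespace LevelAlgebra

/-! ### Ranks of linear maps -/

/-- If `f` has the largest rank in the pencil `f + c g`, then `g` maps the kernel of `f` into the
range of `f`: otherwise, for a suitable `c ≠ 0`, the images of a complement of `ker f` under
`f + c g`, together with `g y`, span a space of dimension `rank f + 1`. -/
theorem mem_range_of_forall_finrank_range_le {k V W : Type*} [Field k] [Infinite k]
    [AddCommGroup V] [Module k V] [FiniteDimensional k V]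
    [AddCommGroup W] [Module k W] [FiniteDimensional k W] (f g : V →ₗ[k] W)
    (h : ∀ c : k, finrank k (LinearMap.range (f + c • g)) ≤ finrank k (LinearMap.range f))
    {y : V} (hy : f y = 0) : g y ∈ LinearMap.range f := by
  by_contra hgy
  obtain ⟨U, hU⟩ := Submodule.exists_isCompl (LinearMap.ker f)
  have hUdim : finrank k U = finrank k (LinearMap.range f) := by
    have h1 := Submodule.finrank_add_eq_of_isCompl hU
    have h2 := f.finrank_range_add_finrank_ker
    omega
  -- `P` is the map `(u, a) ↦ f u + a g y`, and `P + c N` the map `(u, a) ↦ (f + c g) u + a g y`.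
  let P : (U × k) →ₗ[k] W := (f.comp U.subtype).coprod (LinearMap.toSpanSingleton k W (g y))
  let N : (U × k) →ₗ[k] W := (g.comp U.subtype).comp (LinearMap.fst k U k)
  have hP : LinearMap.ker P = ⊥ := by
    rw [LinearMap.ker_eq_bot']
    rintro ⟨u, a⟩ hua
    have hua' : f u + a • g y = 0 := by simpa [P] using hua
    have ha : a = 0 := by
      by_contra ha
      refine hgy ⟨-(a⁻¹ • (u : V)), ?_⟩
      rw [map_neg, map_smul, eq_neg_of_add_eq_zero_left hua', smul_neg, neg_neg,
        inv_smul_smul₀ ha]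
    have hu : (u : V) ∈ LinearMap.ker f ⊓ U := ⟨by simpa [ha] using hua', u.2⟩
    rw [hU.inf_eq_bot, Submodule.mem_bot] at hu
    simp [ha, Subtype.ext_iff, hu]
  obtain ⟨q, hq⟩ := P.exists_leftInverse_of_injective hP
  -- `P + c N` is injective as soon as `-1 / c` is not an eigenvalue of `q ∘ N`.
  obtain ⟨μ, hμ⟩ :=
    ((End.finite_hasEigenvalue (q ∘ₗ N)).union (Set.finite_singleton 0)).exists_notMem
  simp only [Set.mem_union, Set.mem_ofPred_eq, Set.mem_singleton_iff, not_or] at hμ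
  obtain ⟨hμ1, hμ0⟩ := hμ
  set c : k := -μ⁻¹ with hc
  have hc0 : c ≠ 0 := neg_ne_zero.mpr (inv_ne_zero hμ0)
  have hinj : Function.Injective (P + c • N) := by
    rw [← LinearMap.ker_eq_bot, LinearMap.ker_eq_bot']
    intro z hz
    by_contra hz0
    refine hμ1 (End.hasEigenvalue_of_hasEigenvector (x := z) ⟨?_, hz0⟩)
    have h1 : q (P z) + c • q (N z) = 0 := by
      simpa using congrArg q hz
    have h2 : q (P z) = z := LinearMap.congr_fun hq z
    rw [End.mem_eigenspace_iff, LinearMap.comp_apply]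
    rw [h2, hc, neg_smul, ← sub_eq_add_neg, sub_eq_zero] at h1
    conv_rhs => rw [h1, smul_inv_smul₀ hμ0]
  have hrange : LinearMap.range (P + c • N) ≤ LinearMap.range (f + c • g) := by
    rintro _ ⟨⟨u, a⟩, rfl⟩
    refine ⟨(u : V) + (a * c⁻¹) • y, ?_⟩
    simp [P, N, hy, smul_smul, mul_left_comm c a, hc0]
    abel
  have h1 := Submodule.finrank_mono hrange
  rw [LinearMap.finrank_range_of_inj hinj, finrank_prod, finrank_self, hUdim] at h1
  have h2 := h c
  omega

theorem finrank_map_add_finrank_inf_ker {k V W : Type*} [Field k]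
    [AddCommGroup V] [Module k V] [FiniteDimensional k V] [AddCommGroup W] [Module k W]
    (f : V →ₗ[k] W) (N : Submodule k V) :
    finrank k (N.map f) + finrank k ↥(N ⊓ LinearMap.ker f) = finrank k N := by
  have h := (f.domRestrict N).finrank_range_add_finrank_ker
  have h' : finrank k ((LinearMap.ker f).comap N.subtype) = finrank k ↥(N ⊓ LinearMap.ker f) := by
    rw [← Submodule.map_comap_subtype]
    exact LinearEquiv.finrank_eq (Submodule.equivSubtypeMap N _)
  rw [LinearMap.range_domRestrict, LinearMap.ker_domRestrict] at h
  omega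

theorem finrank_le_one_of_forall_apply_eq_zero {k M : Type*} [Field k] [AddCommGroup M] [Module k M]
    {P : Submodule k (Dual k M)} {x : M} (h : ∀ f ∈ P, f x = 0 → f = 0) : finrank k P ≤ 1 := by
  let ev : P →ₗ[k] k := (Dual.eval k M x) ∘ₗ P.subtype
  have hev : Function.Injective ev :=
    fun f g hfg => Subtype.ext <| sub_eq_zero.mp <| h _ (P.sub_mem f.2 g.2) <| by
      rw [LinearMap.sub_apply, sub_eq_zero]
      exact hfg
  simpa using LinearMap.finrank_le_finrank_of_injective hev

/-! ### The bilinear forms defined by functionals -/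

section Pairing

variable {k A : Type*} [Field k] [CommRing A] [Algebra k A]

/-- The bilinear form `(v, b) ↦ ψ (v b)` on `V × B`, as a map from `V` to the dual of `B`. -/
noncomputable def pairing (V B : Submodule k A) (ψ : Dual k A) : V →ₗ[k] Dual k B :=
  ((LinearMap.mul k A).compr₂ ψ).domRestrict₁₂ V B

@[simp]
theorem pairing_apply (V B : Submodule k A) (ψ : Dual k A) (v : V) (b : B) :
    pairing V B ψ v b = ψ (v * b) := rfl

theorem pairing_add_smul (V B : Submodule k A) (φ ψ : Dual k A) (c : k) :
    pairing V B (φ + c • ψ) = pairing V B φ + c • pairing V B ψ := by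
  ext; simp

theorem finiteDimensional_pow (V : Submodule k A) [FiniteDimensional k V] (m : ℕ) :
    FiniteDimensional k ↥(V ^ m) :=
  Module.Finite.iff_fg.mpr ((Module.Finite.iff_fg.mp ‹_›).pow m)

theorem finiteDimensional_mul (V W : Submodule k A) [FiniteDimensional k V]
    [FiniteDimensional k W] :
    FiniteDimensional k ↥(V * W) :=
  Module.Finite.iff_fg.mpr ((Module.Finite.iff_fg.mp ‹_›).mul (Module.Finite.iff_fg.mp ‹_›))

/-- The rank of the pairing plus the dimension of a subspace of its right kernel is at most the
dimension of the right factor. -/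
theorem finrank_range_pairing_add_le {V B N : Submodule k A} [FiniteDimensional k B]
    {ψ : Dual k A} (hNB : N ≤ B) (h : ∀ v ∈ V, ∀ z ∈ N, ψ (v * z) = 0) :
    finrank k (LinearMap.range (pairing V B ψ)) + finrank k N ≤ finrank k B := by
  have h1 := Subspace.finrank_add_finrank_dualCoannihilator_eq (LinearMap.range (pairing V B ψ))
  have h2 : N.comap B.subtype ≤ (LinearMap.range (pairing V B ψ)).dualCoannihilator := by
    intro z hz
    rw [Submodule.mem_dualCoannihilator]
    rintro _ ⟨v, rfl⟩
    exact h v v.2 z hz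
  have h3 := Submodule.finrank_mono h2
  rw [(Submodule.comapSubtypeEquivOfLe hNB).finrank_eq] at h3
  omega

/-- If `N` lies in the left kernel of the form of `ψ` on `V × V ^ (m + 1)`, then `N V ^ m` pairs to
zero with `V`, because the product of `V ^ m` and `V` lies in `V ^ (m + 1)`. -/
theorem apply_mul_eq_zero_of_le_ker {V : Submodule k A} {N : Submodule k V} {ψ : Dual k A} {m : ℕ}
    (hN : N ≤ LinearMap.ker (pairing V (V ^ (m + 1)) ψ)) {v z : A} (hv : v ∈ V)
    (hz : z ∈ N.map V.subtype * V ^ m) : ψ (v * z) = 0 := by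
  have hle : N.map V.subtype * V ^ m ≤ LinearMap.ker (ψ ∘ₗ LinearMap.mulLeft k v) := by
    rw [Submodule.mul_le]
    rintro _ ⟨y, hy, rfl⟩ c hc
    have hvc : v * c ∈ V ^ (m + 1) := by
      rw [pow_succ']
      exact Submodule.mul_mem_mul hv hc
    have h : ψ (y * (v * c)) = 0 := LinearMap.congr_fun (LinearMap.mem_ker.mp (hN hy)) ⟨_, hvc⟩
    rwa [mul_left_comm] at h
  exact hle hz

theorem pow_succ_le_mul_pow_sup_span {V U : Submodule k A} {x : A} (hx : x ∈ V)
    (hV : V ≤ U ⊔ Submodule.span k {x}) (m : ℕ) :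
    V ^ (m + 1) ≤ U * V ^ m ⊔ Submodule.span k {x ^ (m + 1)} := by
  have hstep : ∀ m, V ^ (m + 1) ≤ U * V ^ m ⊔ Submodule.span k {x} * V ^ m := fun m => by
    rw [pow_succ', ← Submodule.sup_mul]
    exact mul_le_mul' hV le_rfl
  induction m with
  | zero => simpa using hV
  | succ m ih =>
    refine (hstep (m + 1)).trans (sup_le le_sup_left ?_)
    calc Submodule.span k {x} * V ^ (m + 1)
        ≤ Submodule.span k {x} * (U * V ^ m ⊔ Submodule.span k {x ^ (m + 1)}) :=
          mul_le_mul' le_rfl ih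
      _ = U * (Submodule.span k {x} * V ^ m) ⊔ Submodule.span k {x ^ (m + 1 + 1)} := by
          rw [Submodule.mul_sup, Submodule.span_mul_span, Set.singleton_mul_singleton,
            ← pow_succ', mul_left_comm]
      _ ≤ U * V ^ (m + 1) ⊔ Submodule.span k {x ^ (m + 1 + 1)} := ?_
    refine sup_le_sup_right (mul_le_mul' le_rfl ?_) _
    rw [pow_succ' V m]
    exact mul_le_mul' ((Submodule.span_singleton_le_iff_mem _ _).mpr hx) le_rfl

/-- If `χ` kills all products `n u c` with `n ∈ N`, `u ∈ U` and `c ∈ V ^ m`, and `U` has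
codimension at most one in `V`, then the pairing of `N` with `V ^ (m + 1)` defined by `χ` has rank
at most the codimension of `U`: if `V = U + ⟨x⟩`, then `χ (n b)`, for `b ∈ V ^ (m + 1)`, depends
only on the coefficient of `x ^ (m + 1)` in `b`. -/
theorem finrank_map_pairing_add_le {V : Submodule k A} [FiniteDimensional k V]
    {N U : Submodule k V} {χ : Dual k A} {m : ℕ}
    (h : ∀ n ∈ N, ∀ u ∈ U, ∀ c ∈ V ^ m, χ (n * (u * c)) = 0)
    (hU : finrank k V ≤ finrank k U + 1) :
    finrank k (N.map (pairing V (V ^ (m + 1)) χ)) + finrank k U ≤ finrank k V := by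
  have hker : ∀ n ∈ N,
      U.map V.subtype * V ^ m ≤ LinearMap.ker (χ ∘ₗ LinearMap.mulLeft k (n : A)) := by
    intro n hn
    rw [Submodule.mul_le]
    rintro _ ⟨u, hu, rfl⟩ c hc
    exact h n hn u hu c hc
  by_cases hUtop : U = ⊤
  · have hbot : N.map (pairing V (V ^ (m + 1)) χ) = ⊥ := by
      rw [eq_bot_iff]
      rintro _ ⟨n, hn, rfl⟩
      rw [Submodule.mem_bot]
      ext b
      have hb := b.2
      have h1 := hker n hn
      rw [hUtop, Submodule.map_top, Submodule.range_subtype, ← pow_succ'] at h1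
      exact h1 hb
    rw [hbot, finrank_bot, zero_add]
    exact Submodule.finrank_le U
  · obtain ⟨x, hx⟩ : ∃ x, x ∉ U := by
      by_contra hcon
      push Not at hcon
      exact hUtop (eq_top_iff.mpr fun x _ => hcon x)
    have hlt : U < U ⊔ Submodule.span k {x} :=
      left_lt_sup.mpr fun hle => hx (hle (Submodule.mem_span_singleton_self x))
    have hltdim := Submodule.finrank_lt_finrank_of_lt hlt
    have hsup : U ⊔ Submodule.span k {x} = ⊤ := by
      apply Submodule.eq_top_of_finrank_eq
      have := Submodule.finrank_le (U ⊔ Submodule.span k {x})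
      omega
    have hV : V ≤ U.map V.subtype ⊔ Submodule.span k {(x : A)} := by
      have h1 := congrArg (Submodule.map V.subtype) hsup
      rw [Submodule.map_sup, Submodule.map_span, Set.image_singleton, Submodule.map_top,
        Submodule.range_subtype] at h1
      exact h1.ge
    have hpow := pow_succ_le_mul_pow_sup_span x.2 hV m
    have hxm : (x : A) ^ (m + 1) ∈ V ^ (m + 1) := Submodule.pow_mem_pow V x.2 _
    have h1 : finrank k (N.map (pairing V (V ^ (m + 1)) χ)) ≤ 1 := by
      refine finrank_le_one_of_forall_apply_eq_zero (x := ⟨_, hxm⟩) ?_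
      rintro _ ⟨n, hn, rfl⟩ hz
      ext b
      have hle : V ^ (m + 1) ≤ LinearMap.ker (χ ∘ₗ LinearMap.mulLeft k (n : A)) := by
        refine hpow.trans (sup_le (hker n hn) ?_)
        rw [Submodule.span_singleton_le_iff_mem]
        exact hz
      exact hle b.2
    have h2 : finrank k U < finrank k V := by
      have := Submodule.finrank_le (U ⊔ Submodule.span k {x})
      omega
    omega

/-! ### Subspaces of the left kernel of a form of maximal rank -/

/-- The rank `d` of `ψ` on `N × V ^ (m + 1)` is at most its rank `σ` on `V × N V ^ m`; this is the
step that needs the bound `7` on the dimension of `V`. The hypothesis `hφ` expresses that every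
functional `b ↦ ψ (y b)` with `y ∈ N` is of the form `b ↦ φ (D b)` for some `D ∈ V`; it holds when
the form of `φ` has maximal rank. -/
theorem finrank_map_pairing_le_finrank_range {V : Submodule k A} [FiniteDimensional k V] {m : ℕ}
    (hV : finrank k V ≤ 7) {φ ψ : Dual k A}
    {N : Submodule k V} (hN : N ≤ LinearMap.ker (pairing V (V ^ (m + 1)) φ))
    (hφ : N.map (pairing V (V ^ (m + 1)) ψ) ≤ LinearMap.range (pairing V (V ^ (m + 1)) φ)) :
    finrank k (N.map (pairing V (V ^ (m + 1)) ψ)) ≤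
      finrank k (LinearMap.range (pairing V (N.map V.subtype * V ^ m) ψ)) := by
  have := finiteDimensional_pow V (m + 1)
  set βφ := pairing V (V ^ (m + 1)) φ
  set βψ := pairing V (V ^ (m + 1)) ψ
  set θ := pairing V (N.map V.subtype * V ^ m) ψ
  set S' := LinearMap.ker θ
  set S := (N.map βψ).comap βφ with hS
  have hσ : finrank k (LinearMap.range θ) + finrank k S' = finrank k V :=
    θ.finrank_range_add_finrank_ker
  -- By definition of `S'`, the functional `ψ` kills `N S' V ^ m`; it takes the same values there as
  -- `φ` takes on `S S' V ^ m`, so `φ` kills the latter.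
  have h1 : finrank k V ≤ finrank k S' + 1 →
      finrank k (N.map βψ) + finrank k S' ≤ finrank k V := by
    refine finrank_map_pairing_add_le ?_
    intro n hn u hu c hc
    have h := LinearMap.congr_fun (LinearMap.mem_ker.mp hu)
      ⟨n * c, Submodule.mul_mem_mul (Submodule.mem_map_of_mem hn) hc⟩
    rw [mul_left_comm]
    exact h
  have h2 : finrank k V ≤ finrank k S + 1 →
      finrank k (S'.map βφ) + finrank k S ≤ finrank k V := by
    refine finrank_map_pairing_add_le ?_
    rintro n hn u ⟨y, hy, hyu⟩ c hc
    have hnc : (n : A) * c ∈ V ^ (m + 1) := by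
      rw [pow_succ']
      exact Submodule.mul_mem_mul n.2 hc
    have h := LinearMap.congr_fun hyu ⟨n * c, hnc⟩
    have h' := LinearMap.congr_fun (LinearMap.mem_ker.mp hn)
      ⟨y * c, Submodule.mul_mem_mul (Submodule.mem_map_of_mem hy) hc⟩
    rw [pairing_apply, pairing_apply] at h
    rw [mul_left_comm, ← h, mul_left_comm]
    exact h'
  have hSdim : finrank k (N.map βψ) + finrank k (LinearMap.ker βφ) = finrank k S := by
    have h := finrank_map_add_finrank_inf_ker βφ S
    rwa [hS, Submodule.map_comap_eq, inf_eq_right.mpr hφ,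
      inf_eq_right.mpr (LinearMap.ker_le_comap (f := βφ) (p := N.map βψ)), ← hS] at h
  have hS'dim : finrank k S' ≤ finrank k (S'.map βφ) + finrank k (LinearMap.ker βφ) := by
    have h := finrank_map_add_finrank_inf_ker βφ S'
    have h' := Submodule.finrank_mono (inf_le_right : S' ⊓ LinearMap.ker βφ ≤ _)
    omega
  have hd := Submodule.finrank_map_le βψ N
  have hNK : finrank k N ≤ finrank k (LinearMap.ker βφ) := Submodule.finrank_mono hN
  have hSle := Submodule.finrank_le S
  -- If `d > σ` and both `S'` and `S` have codimension at least two, then `σ = codim S'` gives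
  -- `d ≥ 3`, and `dim S = s + d`, where `s` is the dimension of `ker βφ` and `d ≤ s`, gives
  -- `dim V ≥ s + d + 2 ≥ 8`.
  by_contra hlt
  by_cases hc1 : finrank k V ≤ finrank k S' + 1
  · have := h1 hc1
    omega
  by_cases hc2 : finrank k V ≤ finrank k S + 1
  · have := h2 hc2
    omega
  omega

/-- Multiplication by `V ^ m` does not lower the dimension of a subspace of the left kernel of a
form of maximal rank, if no non-zero element of `V` annihilates `V ^ (m + 1)`. -/
theorem finrank_le_finrank_mul_pow {V : Submodule k A} [FiniteDimensional k V] {m : ℕ}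
    (hV : finrank k V ≤ 7) (hfaithful : ∀ y ∈ V, y ≠ 0 → ∃ b ∈ V ^ (m + 1), y * b ≠ 0)
    {φ : Dual k A}
    (hφ : ∀ ψ, (LinearMap.ker (pairing V (V ^ (m + 1)) φ)).map (pairing V (V ^ (m + 1)) ψ) ≤
      LinearMap.range (pairing V (V ^ (m + 1)) φ))
    (N : Submodule k V) (hN : N ≤ LinearMap.ker (pairing V (V ^ (m + 1)) φ)) :
    finrank k N ≤ finrank k ↥(N.map V.subtype * V ^ m) := by
  induction hd : finrank k N using Nat.strong_induction_on generalizing N with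
  | _ d ih =>
  subst hd
  by_cases hbot : N = ⊥
  · rw [hbot]
    exact (finrank_bot k V).trans_le (Nat.zero_le _)
  obtain ⟨y, hy, hy0⟩ := N.ne_bot_iff.mp hbot
  obtain ⟨b, hb, hyb⟩ := hfaithful y y.2 (fun h => hy0 (Subtype.ext h))
  obtain ⟨ψ, hψ⟩ := Projective.exists_dual_ne_zero k hyb
  have hNψ := finrank_map_pairing_le_finrank_range hV hN ((Submodule.map_mono hN).trans (hφ ψ))
  set βψ := pairing V (V ^ (m + 1)) ψ
  have hN₁ : N ⊓ LinearMap.ker βψ < N := by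
    refine lt_of_le_of_ne inf_le_left fun heq => hψ ?_
    have h := (heq.ge hy).2
    exact LinearMap.congr_fun (LinearMap.mem_ker.mp h) ⟨b, hb⟩
  have hih := ih _ (Submodule.finrank_lt_finrank_of_lt hN₁) _ (hN₁.le.trans hN) rfl
  have := finiteDimensional_pow V m
  have := finiteDimensional_mul (N.map V.subtype) (V ^ m)
  have hle := finrank_range_pairing_add_le (V := V) (B := N.map V.subtype * V ^ m)
    (N := (N ⊓ LinearMap.ker βψ).map V.subtype * V ^ m) (ψ := ψ) ?_ ?_
  · have h := finrank_map_add_finrank_inf_ker βψ N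
    omega
  · exact mul_le_mul' (Submodule.map_mono inf_le_left) le_rfl
  · exact fun v hv z hz => apply_mul_eq_zero_of_le_ker inf_le_right hv hz

/-- A finite-dimensional subspace `V`, of dimension at most `7`, of a commutative algebra is no
larger than `V ^ (m + 1)`, if no non-zero element of `V` annihilates `V ^ (m + 1)`. -/
theorem finrank_le_finrank_pow_succ [Infinite k] {V : Submodule k A} [FiniteDimensional k V]
    {m : ℕ} (hV : finrank k V ≤ 7)
    (hfaithful : ∀ y ∈ V, y ≠ 0 → ∃ b ∈ V ^ (m + 1), y * b ≠ 0) :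
    finrank k V ≤ finrank k ↥(V ^ (m + 1)) := by
  have := finiteDimensional_pow V (m + 1)
  let rk : Dual k A → ℕ := fun ψ => finrank k (LinearMap.range (pairing V (V ^ (m + 1)) ψ))
  have hbdd : BddAbove (Set.range rk) := by
    refine ⟨finrank k V, ?_⟩
    rintro _ ⟨ψ, rfl⟩
    exact LinearMap.finrank_range_le _
  obtain ⟨φ, hφ⟩ : ∃ φ, ∀ ψ, rk ψ ≤ rk φ := by
    obtain ⟨φ, hφ⟩ := Nat.sSup_mem (Set.range_nonempty rk) hbdd
    exact ⟨φ, fun ψ => hφ ▸ le_csSup hbdd ⟨ψ, rfl⟩⟩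
  let K := LinearMap.ker (pairing V (V ^ (m + 1)) φ)
  have hKmul := finrank_le_finrank_mul_pow hV hfaithful (φ := φ) (fun ψ => by
    rintro _ ⟨y, hy, rfl⟩
    refine mem_range_of_forall_finrank_range_le _ _ (fun c => ?_) (LinearMap.mem_ker.mp hy)
    rw [← pairing_add_smul]
    exact hφ (φ + c • ψ)) K le_rfl
  have hle := finrank_range_pairing_add_le (V := V) (B := V ^ (m + 1))
    (N := K.map V.subtype * V ^ m) (ψ := φ) ?_ ?_
  · have : finrank k _ + finrank k K = finrank k V :=
      (pairing V (V ^ (m + 1)) φ).finrank_range_add_finrank_ker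
    omega
  · rw [pow_succ']
    exact mul_le_mul' (Submodule.map_subtype_le V K) le_rfl
  · exact fun v hv z hz => apply_mul_eq_zero_of_le_ker le_rfl hv hz

end Pairing

/-! ### Level algebras -/

section Level

variable {k : Type*} [Field k] {n : ℕ} (I : Ideal (MvPolynomial (Fin n) k))

theorem component_eq_pow (i : ℕ) : component I i = component I 1 ^ i := by
  rw [component, component, ← MvPolynomial.homogeneousSubmodule_one_pow, Submodule.map_pow]

instance finiteDimensional_component (i : ℕ) : FiniteDimensional k (component I i) :=
  Module.Finite.iff_fg.mpr ((MvPolynomial.homogeneousSubmodule_fg (Fin n) k i).map _)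

variable {I}

theorem mk_X_mul_mem_component (j : Fin n) {i : ℕ} {z : MvPolynomial (Fin n) k ⧸ I}
    (hz : z ∈ component I i) :
    Ideal.Quotient.mk I (MvPolynomial.X j) * z ∈ component I (i + 1) := by
  obtain ⟨p, hp, rfl⟩ := hz
  refine ⟨MvPolynomial.X j * p, ?_, map_mul (Ideal.Quotient.mk I) _ _⟩
  rw [add_comm]
  exact (MvPolynomial.isHomogeneous_X k j).mul hp

theorem exists_mk_X_mul_ne_zero {i : ℕ} (h : socleVector I i = 0)
    {z : MvPolynomial (Fin n) k ⧸ I} (hz : z ∈ component I i) (hz0 : z ≠ 0) :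
    ∃ j, Ideal.Quotient.mk I (MvPolynomial.X j) * z ≠ 0 := by
  by_contra! hcon
  have hfin : FiniteDimensional k ↥((socle I).restrictScalars k ⊓ component I i) :=
    Submodule.finiteDimensional_inf_right _ _
  rw [socleVector, Submodule.finrank_eq_zero] at h
  refine hz0 ((Submodule.mem_bot k).mp (h.le ⟨?_, hz⟩))
  change z ∈ Submodule.annihilator (Submodule.span _ _)
  rw [Submodule.mem_annihilator_span]
  rintro ⟨_, j, rfl⟩
  rw [smul_eq_mul, mul_comm]
  exact hcon j

/-- If the socle vanishes in degrees below `i + m`, an element of degree `i` that is annihilated by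
all of `A_m` is zero. -/
theorem exists_mem_component_mul_ne_zero {i m : ℕ} (h : ∀ l < i + m, socleVector I l = 0)
    {z : MvPolynomial (Fin n) k ⧸ I} (hz : z ∈ component I i) (hz0 : z ≠ 0) :
    ∃ b ∈ component I m, z * b ≠ 0 := by
  induction m generalizing i z with
  | zero =>
    exact ⟨1, ⟨1, MvPolynomial.isHomogeneous_one _ _, map_one (Ideal.Quotient.mk I)⟩,
      by simpa using hz0⟩
  | succ m ih =>
    obtain ⟨j, hj⟩ := exists_mk_X_mul_ne_zero (h i (by omega)) hz hz0
    obtain ⟨b, hb, hne⟩ := ih (fun l hl => h l (by omega)) (mk_X_mul_mem_component j hz) hj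
    exact ⟨_, mk_X_mul_mem_component j hb, by rwa [mul_left_comm, ← mul_assoc]⟩

end Level

end LevelAlgebra

theorem theorem2p14 {k : Type*} [Field k] [Infinite k] {n : ℕ}
    (I : Ideal (MvPolynomial (Fin n) k)) (e t : ℕ)
    (hA : LevelAlgebra.IsLevel I e t) (he : 2 ≤ e)
    (hr : LevelAlgebra.codimension I ≤ 7) :
    LevelAlgebra.codimension I ≤ LevelAlgebra.hVector I (e - 1) := by
  obtain ⟨m, rfl⟩ : ∃ m, e = m + 2 := ⟨e - 2, by omega⟩
  have hpow : m + 2 - 1 = m + 1 := rfl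
  rw [LevelAlgebra.codimension, LevelAlgebra.hVector] at hr
  rw [LevelAlgebra.codimension, LevelAlgebra.hVector, LevelAlgebra.hVector, hpow,
    LevelAlgebra.component_eq_pow I (m + 1)]
  refine LevelAlgebra.finrank_le_finrank_pow_succ hr fun y hy hy0 => ?_
  rw [← LevelAlgebra.component_eq_pow]
  exact LevelAlgebra.exists_mem_component_mul_ne_zero
    (fun l hl => hA.socleVector_eq_zero l (by omega)) hy hy0
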